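/- Let $n\ge 2$ and consider the repeated balls-into-bins process with FIFO queues: $n$ balls are initially placed in the queues of $n$ bins in an arbitrary way and order; in every round each non-empty bin simultaneously releases the ball at the head of its queue, and each released ball is independently re-assigned to one of the $n$ bins chosen uniformly at random and joins the tail of that bin's queue (balls entering the same bin in the same round join in an order given by an arbitrary rule that may depend on the past and on the present round, but not on the future). The \emph{progress} of a ball over a sequence of rounds is the number of those rounds in which it is selected (released from its current queue). The \emph{parallel cover time} is the least number of rounds within which every ball has visited every bin, the initial position of a ball counting as visited. A configuration is \emph{$K$-legitimate} if every bin holds at most $K\log n$ balls. Let $\gamma>0$. (1) For all $c\in\mathbb N$ and $K\in\mathbb R$ there is a constant $C=C(\gamma,c,K)>0$ such that for every $n\ge2$, every tie-breaking rule and every $K$-legitimate initial configuration, with probability at least $1-n^{-\gamma}$ the following holds: for every sequence of $t\ge C\log n$ consecutive rounds among the first $n^c$ rounds, every ball has progress at least $\frac{t}{C\log n}$ over this sequence. (2) For every $c\in\mathbb N$ there is a constant $C=C(\gamma,c)>0$ such that for every $n\ge2$, every tie-breaking rule and \emph{every} initial configuration, with probability at least $1-n^{-\gamma}$ the following holds: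 for every sequence of $t\ge Cn$ consecutive rounds among the first $n^c$ rounds, every ball has progress at least $\frac{t}{C\log n}$ over this sequence. (3) There is a constant $C=C(\gamma)>0$ such that for every $n\ge2$, every tie-breaking rule and every initial configuration, with probability at least $1-n^{-\gamma}$ the parallel cover time is at most $C\,n\log^2 n$. -/

import Mathlib

open MeasureTheory ProbabilityTheory

namespace RepeatedBallsIntoBins

/-- A configuration of `n` labelled balls in `n` bins: each bin holds the queue (list) of the balls
in it, the head of the list being the next ball to be served. -/
abbrev Queues (n : ℕ) := Fin n → List (Fin n)

/-- Every one of the `n` balls lies in exactly one place of exactly one queue. -/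
def IsConfiguration {n : ℕ} (q : Queues n) : Prop :=
  ∀ i : Fin n, ∑ b : Fin n, (q b).count i = 1

/-- The maximum number of balls inside one bin. -/
def maxLoad {n : ℕ} (q : Queues n) : ℕ :=
  Finset.univ.sup fun b => (q b).length

/-- A configuration is legitimate, with constant `K`, if its maximum load is at most `K log n`. -/
def IsLegitimate {n : ℕ} (K : ℝ) (q : Queues n) : Prop :=
  (maxLoad q : ℝ) ≤ K * Real.log n

/-- The random choices: `ω t b` is the bin to which the ball released by bin `b` in round `t` is
re-assigned (it is ignored if bin `b` is empty at the beginning of round `t`). -/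
abbrev Choices (n : ℕ) := ℕ → Fin n → Fin n

/-- All the choices `ω t b` are independent and uniformly distributed over the `n` bins. -/
noncomputable def law (n : ℕ) : Measure (Choices n) :=
  Measure.infinitePi fun _ : ℕ => Measure.pi fun _ : Fin n => uniformOn (Set.univ : Set (Fin n))

/-- A rule for the order in which balls that enter the same bin in the same round `t` join its
queue: a ranking of the bins they come from. It may depend on everything that has happened up to
and including round `t` (that is, on the choices of rounds `0, …, t`), but not on the future. -/
abbrev TieBreak (n : ℕ) := (t : ℕ) → (Fin (t + 1) → Fin n → Fin n) → Equiv.Perm (Fin n)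

/-- The balls that enter bin `b` in one round, where `dest` gives the destinations of the released
balls and the source bins are scanned in the order `σ 0, σ 1, …`. Every non-empty bin
releases the ball at the head of its queue. -/
def arrivals {n : ℕ} (σ : Equiv.Perm (Fin n)) (dest : Fin n → Fin n) (q : Queues n)
    (b : Fin n) : List (Fin n) :=
  (List.finRange n).filterMap fun k => if dest (σ k) = b then (q (σ k)).head? else none

/-- One synchronous round under FIFO: every non-empty bin releases the head of its queue, and the
released balls are appended at the tails of the queues of their destinations. -/
def step {n : ℕ} (σ : Equiv.Perm (Fin n)) (dest : Fin n → Fin n) (q : Queues n) : Queues n :=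
  fun b => (q b).tail ++ arrivals σ dest q b

/-- The configuration after `t` rounds (at the beginning of round `t`), started from `q₀`. -/
def process {n : ℕ} (τ : TieBreak n) (q₀ : Queues n) (ω : Choices n) : ℕ → Queues n
  | 0 => q₀
  | t + 1 => step (τ t fun s => ω s) (ω t) (process τ q₀ ω t)

/-- Ball `i` is selected from its current bin queue in round `t`. -/
def Selected {n : ℕ} (τ : TieBreak n) (q₀ : Queues n) (ω : Choices n) (i : Fin n) (t : ℕ) : Prop :=
  ∃ b : Fin n, (process τ q₀ ω t b).head? = some i

open Classical in
/-- The progress of ball `i` in the `t` rounds `s, s + 1, …, s + t - 1`: the number of those rounds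
in which it is selected. -/
noncomputable def progress {n : ℕ} (τ : TieBreak n) (q₀ : Queues n) (ω : Choices n) (i : Fin n)
    (s t : ℕ) : ℕ :=
  ((Finset.Ico s (s + t)).filter fun r => Selected τ q₀ ω i r).card

/-- Within the first `T` rounds every ball has visited every bin. -/
def CoveredBy {n : ℕ} (τ : TieBreak n) (q₀ : Queues n) (ω : Choices n) (T : ℕ) : Prop :=
  ∀ i b : Fin n, ∃ s ≤ T, i ∈ process τ q₀ ω s b

/-- The parallel cover time: the least number of rounds within which every ball has visited every
bin (`⊤` if there is none). -/
noncomputable def parallelCoverTime {n : ℕ} (τ : TieBreak n) (q₀ : Queues n) (ω : Choices n) : ℕ∞ :=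
  ⨅ T ∈ {T : ℕ | CoveredBy τ q₀ ω T}, (T : ℕ∞)

end RepeatedBallsIntoBins

/-! Everything rests on the maximum load staying logarithmic for polynomially many rounds. If no bin
exceeds `M` balls throughout `M` rounds, FIFO serves every ball at least once in them
(`le_progress_mul`), so a load of order `log n` yields progress at rate `1 / log n`.

The load bound has two ingredients. From any configuration at least half of the bins hold at most
one ball; each of these becomes empty if no ball lands in it, which happens with probability at
least about `1/5`. Hence after one round at least `n/16` bins are empty, outside an event of
exponentially small probability (`average_card_occupied_le`). While this lasts, a bin receives fewer
than one ball per round on average but releases one whenever it is non-empty, so `(17/16) ^ load`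
contracts in expectation up to an additive constant (`average_pow_length_step_le`). Markov's
inequality and a union bound over bins and rounds give `exists_law_maxLoad_le`. A legitimate start
has polynomial potential from the outset; an arbitrary start has potential at most `(17/16) ^ n`,
which `256 n` rounds of contraction remove.

For the cover time, each release of a ball misses a fixed bin with probability `1 - 1/n`,
independently of the past. The number of releases is random and entangled with the other balls, so
the supermartingale `avoidance` replaces an independence argument. After order `n log n` releases, a
union bound over ball-bin pairs finishes the proof. -/

namespace RepeatedBallsIntoBins

/-! ### Queue dynamics: loads, conservation of balls, progress under FIFO -/

/-- The non-empty bins. -/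
def occupied {n : ℕ} (q : Queues n) : Finset (Fin n) :=
  Finset.univ.filter fun b => q b ≠ []

theorem mem_occupied {n : ℕ} {q : Queues n} {b : Fin n} : b ∈ occupied q ↔ q b ≠ [] := by
  simp [occupied]

theorem countP_finRange {n : ℕ} (p : Fin n → Bool) :
    (List.finRange n).countP p = ∑ k, if p k then 1 else 0 := by
  rw [Fin.sum_univ_def]
  induction List.finRange n with
  | nil => simp
  | cons a l ih => simp [List.countP_cons, ih, add_comm]

/-- Reindexing by the permutation removes `σ` from the count. This is why an adaptive tie-breaking
rule, even one that sees the present round, has no influence on the load estimates. -/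
theorem length_arrivals {n : ℕ} (σ : Equiv.Perm (Fin n)) (dest : Fin n → Fin n) (q : Queues n)
    (b : Fin n) :
    (arrivals σ dest q b).length = ((occupied q).filter fun k => dest k = b).card := by
  rw [arrivals, List.length_filterMap_eq_countP, countP_finRange, occupied, Finset.filter_filter,
    Finset.card_filter]
  rw [← Equiv.sum_comp σ (fun k => if q k ≠ [] ∧ dest k = b then 1 else 0)]
  refine Finset.sum_congr rfl fun k _ => ?_
  by_cases h : dest (σ k) = b <;> simp [h, List.isSome_head?]

theorem sum_count_arrivals {n : ℕ} (σ : Equiv.Perm (Fin n)) (dest : Fin n → Fin n) (q : Queues n)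
    (i : Fin n) :
    ∑ b, (arrivals σ dest q b).count i = ∑ k, if (q k).head? = some i then 1 else 0 := by
  simp only [arrivals, List.count_filterMap, countP_finRange]
  rw [Finset.sum_comm, ← Equiv.sum_comp σ (fun k => if (q k).head? = some i then 1 else 0)]
  refine Finset.sum_congr rfl fun k _ => ?_
  rw [Finset.sum_eq_single (dest (σ k))]
  · simp
  · intro b _ hb
    simp [hb.symm]
  · simp

theorem isConfiguration_step {n : ℕ} (σ : Equiv.Perm (Fin n)) (dest : Fin n → Fin n)
    {q : Queues n} (hq : IsConfiguration q) : IsConfiguration (step σ dest q) := by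
  intro i
  rw [← hq i]
  simp only [step, List.count_append, Finset.sum_add_distrib, sum_count_arrivals]
  rw [← Finset.sum_add_distrib]
  refine Finset.sum_congr rfl fun b _ => ?_
  cases q b with
  | nil => simp
  | cons a l => simp [List.count_cons]

theorem isConfiguration_process {n : ℕ} (τ : TieBreak n) {q₀ : Queues n}
    (h : IsConfiguration q₀) (ω : Choices n) (t : ℕ) : IsConfiguration (process τ q₀ ω t) := by
  induction t with
  | zero => exact h
  | succ t ih => exact isConfiguration_step _ _ ih

theorem IsConfiguration.exists_mem {n : ℕ} {q : Queues n} (hq : IsConfiguration q) (i : Fin n) :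
    ∃ b, i ∈ q b := by
  by_contra! h
  have := hq i
  simp [List.count_eq_zero_of_not_mem (h _)] at this

theorem IsConfiguration.sum_length {n : ℕ} {q : Queues n} (hq : IsConfiguration q) :
    ∑ b, (q b).length = n := by
  have h : ∀ b, (q b).length = ∑ i, (q b).count i := fun b => by
    have := Multiset.sum_count_eq_card (s := Finset.univ) (m := (q b : Multiset (Fin n)))
      (by simp)
    simpa using this.symm
  simp only [h]
  rw [Finset.sum_comm]
  simp [hq _]

theorem IsConfiguration.length_le {n : ℕ} {q : Queues n} (hq : IsConfiguration q) (b : Fin n) :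
    (q b).length ≤ n := by
  conv_rhs => rw [← hq.sum_length]
  exact Finset.single_le_sum (f := fun b => (q b).length) (fun _ _ => Nat.zero_le _)
    (Finset.mem_univ b)

theorem length_le_maxLoad {n : ℕ} (q : Queues n) (b : Fin n) : (q b).length ≤ maxLoad q :=
  Finset.le_sup (f := fun b => (q b).length) (Finset.mem_univ b)

/-- Arrivals join behind, so a waiting ball moves forward by exactly one place per round. -/
theorem exists_selected_of_getElem? {n : ℕ} (τ : TieBreak n) (q₀ : Queues n) (ω : Choices n)
    (i b : Fin n) (p r : ℕ) (h : (process τ q₀ ω r b)[p]? = some i) :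
    Selected τ q₀ ω i (r + p) := by
  induction p generalizing r with
  | zero => exact ⟨b, by simpa [List.head?_eq_getElem?] using h⟩
  | succ p ih =>
    have := ih (r + 1) (by
      have hl := (List.getElem?_eq_some_iff.1 h).1
      rw [process, step, List.getElem?_append_left (by simp; omega)]
      simpa using h)
    rwa [show r + (p + 1) = r + 1 + p by ring]

theorem progress_add {n : ℕ} (τ : TieBreak n) (q₀ : Queues n) (ω : Choices n) (i : Fin n)
    (s a b : ℕ) :
    progress τ q₀ ω i s (a + b) = progress τ q₀ ω i s a + progress τ q₀ ω i (s + a) b := by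
  classical
  unfold progress
  rw [← Finset.card_union_of_disjoint, ← Finset.filter_union, ← add_assoc,
    Finset.Ico_union_Ico_eq_Ico (by omega) (by omega)]
  exact Finset.disjoint_filter_filter (Finset.Ico_disjoint_Ico_consecutive _ _ _)

theorem progress_mono {n : ℕ} (τ : TieBreak n) (q₀ : Queues n) (ω : Choices n) (i : Fin n)
    (s : ℕ) {a b : ℕ} (h : a ≤ b) : progress τ q₀ ω i s a ≤ progress τ q₀ ω i s b := by
  obtain ⟨d, rfl⟩ := Nat.exists_eq_add_of_le h
  rw [progress_add]
  omega

/-- The window splits into `k` blocks of length `M`. At the start of a block the ball has fewer than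
`M` balls ahead of it, so it is served within the block. -/
theorem le_progress_mul {n : ℕ} (τ : TieBreak n) {q₀ : Queues n} (hq : IsConfiguration q₀)
    (ω : Choices n) (i : Fin n) (s k M : ℕ)
    (hpos : 0 < M) (hM : ∀ r, s ≤ r → r < s + k * M → maxLoad (process τ q₀ ω r) ≤ M) :
    k ≤ progress τ q₀ ω i s (k * M) := by
  induction k with
  | zero => simp
  | succ k ih =>
    have h1 := ih fun r h1 h2 => hM r h1 (by nlinarith)
    obtain ⟨b, hb⟩ := (isConfiguration_process τ hq ω (s + k * M)).exists_mem i
    obtain ⟨p, hp, hpi⟩ := List.getElem_of_mem hb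
    have hpM : p < M := (hp.trans_le (length_le_maxLoad _ b)).trans_le
      (hM _ (by omega) (by nlinarith))
    have hsel := exists_selected_of_getElem? τ q₀ ω i b p (s + k * M)
      (List.getElem?_eq_some_iff.2 ⟨hp, hpi⟩)
    rw [add_mul, one_mul, progress_add]
    refine Nat.add_le_add h1 (Finset.card_pos.2 ⟨s + k * M + p, ?_⟩)
    simp [hsel, hpM]

/-! ### Resampling one round, and expectations -/

/-- Replacing one coordinate of an infinite product by an independent copy preserves the law. -/
theorem measurePreserving_update_infinitePi {ι : Type*} [DecidableEq ι] {X : ι → Type*}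
    [∀ i, MeasurableSpace (X i)] (μ : (i : ι) → Measure (X i)) [∀ i, IsProbabilityMeasure (μ i)]
    (i : ι) :
    MeasurePreserving (fun p : (∀ j, X j) × X i => Function.update p.1 i p.2)
      ((Measure.infinitePi μ).prod (μ i)) (Measure.infinitePi μ) := by
  have hm : Measurable (fun p : (∀ j, X j) × X i => Function.update p.1 i p.2) := by
    refine measurable_pi_lambda _ fun j => ?_
    by_cases h : j = i
    · subst h; simpa using measurable_snd
    · simpa [h] using (measurable_pi_apply j).fun_comp measurable_fst
  refine ⟨hm, Measure.eq_infinitePi _ fun s A hA => ?_⟩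
  rw [Measure.map_apply hm (MeasurableSet.pi s.countable_toSet fun j _ => hA j)]
  by_cases hi : i ∈ s
  · have : (fun p : (∀ j, X j) × X i => Function.update p.1 i p.2) ⁻¹' Set.pi s A =
        (Set.pi (s.erase i : Finset ι) A) ×ˢ A i := by
      ext p
      simp only [Set.mem_preimage, Set.mem_pi, Finset.mem_coe, Set.mem_prod, Finset.mem_erase]
      constructor
      · intro h
        exact ⟨fun j hj => by simpa [hj.1] using h j hj.2, by simpa using h i hi⟩
      · rintro ⟨h1, h2⟩ j hj
        by_cases hji : j = i
        · subst hji; simpa using h2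
        · simpa [hji] using h1 j ⟨hji, hj⟩
    rw [this, Measure.prod_prod, Measure.infinitePi_pi _ fun j _ => hA j,
      Finset.prod_erase_mul _ _ hi]
  · have : (fun p : (∀ j, X j) × X i => Function.update p.1 i p.2) ⁻¹' Set.pi s A =
        (Set.pi s A) ×ˢ Set.univ := by
      ext p
      simp only [Set.mem_preimage, Set.mem_pi, Finset.mem_coe, Set.mem_prod, Set.mem_univ, and_true]
      refine forall₂_congr fun j hj => ?_
      rw [Function.update_of_ne (by rintro rfl; exact hi hj)]
    rw [this, Measure.prod_prod, Measure.infinitePi_pi _ fun j _ => hA j]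
    simp

section Law
variable {n : ℕ}

/-- The average over all the choices of one round. -/
noncomputable def average (F : (Fin n → Fin n) → ℝ) : ℝ :=
  (∑ f, F f) / (n : ℝ) ^ n

theorem average_mono {F G : (Fin n → Fin n) → ℝ} (h : ∀ f, F f ≤ G f) :
    average F ≤ average G := by
  unfold average
  gcongr with f
  exact h f

theorem average_const_mul (a : ℝ) (F : (Fin n → Fin n) → ℝ) :
    average (fun f => a * F f) = a * average F := by
  simp [average, ← Finset.mul_sum, mul_div_assoc]

theorem integral_uniform (F : (Fin n → Fin n) → ℝ) :
    ∫ f, F f ∂(Measure.pi fun _ : Fin n => uniformOn (Set.univ : Set (Fin n))) = average F := by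
  rw [integral_fintype (.of_finite), average, Finset.sum_div]
  refine Finset.sum_congr rfl fun f _ => ?_
  rw [measureReal_def, Measure.pi_singleton]
  simp [uniformOn_univ, div_eq_inv_mul]

/-- Such a function factors through finitely many rounds, that is, through a finite discrete space.
-/
theorem measurable_of_dependsOn {g : Choices n → ℝ} {t : ℕ} (hg : DependsOn g (Set.Iio t)) :
    Measurable g := by
  have hg' : DependsOn g (Finset.range t : Set ℕ) := by simpa using hg
  obtain ⟨h, rfl⟩ := dependsOn_iff_exists_comp.1 hg'
  exact (Measurable.of_discrete (f := h)).comp (measurable_pi_lambda _ fun _ => measurable_pi_apply _)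

variable [NeZero n]

instance isProbabilityMeasure_uniform :
    IsProbabilityMeasure (uniformOn (Set.univ : Set (Fin n))) :=
  isProbabilityMeasure_uniformOn Set.finite_univ Set.univ_nonempty

instance isProbabilityMeasure_law : IsProbabilityMeasure (law n) := by
  unfold law; infer_instance

theorem average_const (a : ℝ) : average (fun _ : Fin n → Fin n => a) = a := by
  have : (n : ℝ) ≠ 0 := NeZero.ne _
  simp [average]

theorem integrable_of_dependsOn {g : Choices n → ℝ} {t : ℕ} (hg : DependsOn g (Set.Iio t)) :
    Integrable g (law n) := by
  have hg' : DependsOn g (Finset.range t : Set ℕ) := by simpa using hg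
  obtain ⟨h, rfl⟩ := dependsOn_iff_exists_comp.1 hg'
  have hm : Measurable (Set.domRestrict (π := fun _ => Fin n → Fin n) (Finset.range t : Set ℕ)) :=
    measurable_pi_lambda _ fun _ => measurable_pi_apply _
  have : IsProbabilityMeasure ((law n).map
      (Set.domRestrict (π := fun _ => Fin n → Fin n) (Finset.range t : Set ℕ))) :=
    Measure.isProbabilityMeasure_map hm.aemeasurable
  exact (Integrable.of_finite (f := h)).comp_measurable hm

/-- Resampling round `t` preserves the law, and Fubini integrates the fresh round first. This plays
the role of conditioning on the other rounds. -/
theorem integral_eq_integral_average {g : Choices n → ℝ} {u : ℕ} (hg : DependsOn g (Set.Iio u))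
    (t : ℕ) :
    ∫ ω, g ω ∂law n = ∫ ω, average (fun f => g (Function.update ω t f)) ∂law n := by
  have hmp := measurePreserving_update_infinitePi
    (fun _ : ℕ => Measure.pi fun _ : Fin n => uniformOn (Set.univ : Set (Fin n))) t
  have hi := integrable_of_dependsOn hg
  change ∫ ω, g ω ∂(Measure.infinitePi _) = _
  rw [← hmp.map_eq, integral_map hmp.measurable.aemeasurable
    (measurable_of_dependsOn hg).aestronglyMeasurable,
    integral_prod (fun p => g (Function.update p.1 t p.2))
      ((hmp.integrable_comp hi.aestronglyMeasurable).2 hi)]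
  simp only [integral_uniform]
  rfl

/-- A drift condition in conditional expectation passes to the expectation. -/
theorem integral_le_of_average_le {g g' : Choices n → ℝ} {t : ℕ} {a d : ℝ}
    (hg : DependsOn g (Set.Iio t)) (hg' : DependsOn g' (Set.Iio (t + 1)))
    (h : ∀ ω, average (fun f => g' (Function.update ω t f)) ≤ a * g ω + d) :
    ∫ ω, g' ω ∂law n ≤ a * ∫ ω, g ω ∂law n + d := by
  rw [integral_eq_integral_average hg' t]
  have hi := integrable_of_dependsOn hg
  calc _ ≤ ∫ ω, (a * g ω + d) ∂law n := by
        refine integral_mono ?_ ((hi.const_mul a).add (integrable_const d)) h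
        refine integrable_of_dependsOn (t := t + 1) fun ω ω' hω => ?_
        refine congrArg average (funext fun f => hg' fun s hs => ?_)
        by_cases hst : s = t
        · subst hst; simp
        · simp [hst, hω s hs]
    _ = _ := by
        rw [integral_add (hi.const_mul a) (integrable_const d), integral_const_mul]
        simp

/-- Markov's inequality. -/
theorem measure_le_of_le {g : Choices n → ℝ} {t : ℕ} (hg : DependsOn g (Set.Iio t))
    (hg0 : ∀ ω, 0 ≤ g ω) {a : ℝ} (ha : 0 < a) {S : Set (Choices n)} (hS : ∀ ω ∈ S, a ≤ g ω) :
    (law n).real S ≤ (∫ ω, g ω ∂law n) / a := by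
  rw [le_div_iff₀' ha]
  refine le_trans ?_ (mul_meas_ge_le_integral_of_nonneg (Filter.Eventually.of_forall hg0)
    (integrable_of_dependsOn hg) a)
  gcongr
  · exact measure_ne_top _ _
  · exact hS

end Law

/-! ### Empty bins when balls are thrown uniformly -/

theorem pow_add_mul_pow_pred_mul_le {a h : ℝ} (ha : 0 ≤ a) (hh : 0 ≤ h) (s : ℕ) :
    a ^ s + s * a ^ (s - 1) * h ≤ (a + h) ^ s := by
  induction s with
  | zero => simp
  | succ s ih =>
    rw [pow_succ (a + h)]
    refine le_trans ?_ (mul_le_mul_of_nonneg_right ih (by positivity))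
    have h1 : 0 ≤ s * a ^ (s - 1) * h * h := by positivity
    cases s with
    | zero => simp
    | succ s =>
      simp only [Nat.add_sub_cancel] at h1 ⊢
      push_cast at h1 ⊢
      have h2 : (a ^ (s + 1) + (s + 1) * a ^ s * h) * (a + h) = a ^ (s + 1 + 1) +
          (s + 1 + 1) * a ^ (s + 1) * h + (s + 1) * a ^ s * h * h := by ring
      linarith

/-- Throwing `m` balls into `n` bins: the generating function of the number of bins of `S` which
stay empty is at most that of independent bins. -/
theorem sum_pow_card_sdiff_image_le {n : ℕ} [NeZero n] {z : ℝ} (hz : 0 ≤ z) (hz1 : z ≤ 1) (m : ℕ)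
    (S : Finset (Fin n)) :
    ∑ f : Fin m → Fin n, z ^ (S \ Finset.univ.image f).card ≤
      (n : ℝ) ^ m * (1 - (1 - z) * (1 - 1 / n) ^ m) ^ S.card := by
  have hn : (1 : ℝ) ≤ n := by exact_mod_cast NeZero.one_le
  have hn1 : (1 : ℝ) / n ≤ 1 := by rw [div_le_one (by linarith)]; exact hn
  have hn0 : (0 : ℝ) ≤ 1 / n := by positivity
  induction m generalizing S with
  | zero => simp
  | succ m ih =>
    set G : ℝ := 1 - (1 - z) * (1 - 1 / n) ^ m with hG
    have hp0 : (0 : ℝ) ≤ (1 - 1 / n) ^ m := pow_nonneg (by linarith) m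
    have hp1 : (1 - 1 / n : ℝ) ^ m ≤ 1 := pow_le_one₀ (by linarith) (by linarith)
    have hG0 : 0 ≤ G := by nlinarith
    have hG1 : 0 ≤ 1 - G := by rw [hG]; nlinarith
    -- One ball is peeled off: if it lands in `x`, the other `m` balls must miss bins of `S.erase
    -- x`. The average over `x` consists of the first two binomial terms of the right-hand power,
    -- and `G + (1 - G) / n` is the value of `G` for `m + 1` balls.
    have key : ∑ x : Fin n, G ^ (S.erase x).card ≤ n * (G + (1 - G) * (1 / n)) ^ S.card := by
      have h1 : ∑ x : Fin n, G ^ (S.erase x).card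
          = S.card * G ^ (S.card - 1) + (n - S.card) * G ^ S.card := by
        rw [← Finset.sum_add_sum_compl S]
        congr 1
        · rw [Finset.sum_congr rfl fun x hx => by rw [Finset.card_erase_of_mem hx]]
          simp
        · rw [Finset.sum_congr rfl fun x hx => by
            rw [Finset.erase_eq_of_notMem (Finset.mem_compl.1 hx)]]
          simp only [Finset.sum_const, Finset.card_compl, Fintype.card_fin, nsmul_eq_mul]
          rw [Nat.cast_sub (by simpa using Finset.card_le_univ S)]
      rw [h1]
      have h2 := pow_add_mul_pow_pred_mul_le hG0 (mul_nonneg hG1 hn0) S.card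
      have h3 : (S.card : ℝ) * G ^ S.card = S.card * (G ^ (S.card - 1) * G) := by
        rcases Nat.eq_zero_or_pos S.card with h | h
        · simp [h]
        · rw [← pow_succ, Nat.sub_add_cancel h]
      calc _ = n * (G ^ S.card + S.card * G ^ (S.card - 1) * ((1 - G) * (1 / n))) := by
            field_simp
            linarith
        _ ≤ _ := mul_le_mul_of_nonneg_left h2 (by linarith)
    rw [← Equiv.sum_comp (Fin.consEquiv fun _ : Fin (m + 1) => Fin n), Fintype.sum_prod_type]
    have himg : ∀ (x : Fin n) (f : Fin m → Fin n),
        S \ Finset.univ.image (Fin.consEquiv (fun _ : Fin (m + 1) => Fin n) (x, f)) =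
          S.erase x \ Finset.univ.image f := fun x f => by
      ext y
      simp only [Finset.mem_sdiff, Finset.mem_image, Finset.mem_univ, true_and, Fin.exists_fin_succ,
        Finset.mem_erase]
      simp only [Fin.consEquiv_apply, Fin.cons_zero, Fin.cons_succ, not_or, eq_comm (a := x)]
      tauto
    simp only [himg]
    calc _ ≤ ∑ x : Fin n, (n : ℝ) ^ m * G ^ (S.erase x).card :=
          Finset.sum_le_sum fun x _ => ih (S.erase x)
      _ = (n : ℝ) ^ m * ∑ x : Fin n, G ^ (S.erase x).card := by rw [Finset.mul_sum]
      _ ≤ (n : ℝ) ^ m * (n * (G + (1 - G) * (1 / n)) ^ S.card) := by gcongr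
      _ = _ := by
        rw [← mul_assoc, ← pow_succ]
        congr 2
        rw [hG]
        ring

/-- Bernoulli's inequality on the whole power gives only `0`; on two halves of the exponent it gives
`1/4` for even `n` and at least `2/9` for odd `n`. -/
theorem one_fifth_le_one_sub_inv_pow {n : ℕ} (hn : 2 ≤ n) : (1 / 5 : ℝ) ≤ (1 - 1 / n) ^ n := by
  have hn' : (2 : ℝ) ≤ n := by exact_mod_cast hn
  have h0 : (0 : ℝ) < 1 / n := by positivity
  have hb : ∀ k : ℕ, (1 - k / n : ℝ) ≤ (1 - 1 / n) ^ k := fun k => by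
    have hn1 : (1 : ℝ) / n ≤ 1 := by rw [div_le_one (by linarith)]; linarith
    have := one_add_mul_le_pow (a := -(1 / n : ℝ)) (by linarith) k
    calc _ = 1 + k * (-(1 / n : ℝ)) := by ring
      _ ≤ _ := this
  rcases Nat.even_or_odd' n with ⟨k, rfl | rfl⟩
  · have h1 := hb k
    have hk : (0 : ℝ) < k := by exact_mod_cast (by omega : 0 < k)
    rw [show (1 - k / (2 * k : ℕ) : ℝ) = 1 / 2 by push_cast; field_simp; norm_num] at h1
    conv_rhs => rw [mul_comm 2 k, pow_mul]
    rw [mul_comm 2 k] at h1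
    nlinarith
  · have hk : (1 : ℝ) ≤ k := by exact_mod_cast (by omega : 1 ≤ k)
    have h1 := hb k
    have h2 := hb (k + 1)
    rw [show (1 - k / (2 * k + 1 : ℕ) : ℝ) = (k + 1) / (2 * k + 1) by push_cast; field_simp; ring]
      at h1
    rw [show (1 - (k + 1 : ℕ) / (2 * k + 1 : ℕ) : ℝ) = k / (2 * k + 1) by
      push_cast; field_simp; ring] at h2
    have h3 := mul_le_mul h1 h2 (by positivity) (le_trans (by positivity) h1)
    rw [← pow_add, show k + (k + 1) = 2 * k + 1 by ring] at h3
    refine le_trans ?_ h3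
    rw [div_mul_div_comm, div_le_div_iff₀ (by norm_num) (by positivity)]
    nlinarith

/-! ### One-round estimates: drift of the load and number of empty bins -/

/-- The number of balls thrown from a set `N` of bins into bin `b` is binomial. -/
theorem average_pow_card {n : ℕ} [NeZero n] (B : ℝ) (N : Finset (Fin n)) (b : Fin n) :
    average (fun f => B ^ (N.filter fun k => f k = b).card) = (1 + (B - 1) / n) ^ N.card := by
  have hn : (n : ℝ) ≠ 0 := NeZero.ne _
  have h1 : ∀ f : Fin n → Fin n, B ^ (N.filter fun k => f k = b).card =
      ∏ k, if k ∈ N ∧ f k = b then B else 1 := fun f => by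
    rw [Finset.prod_ite]
    simp [Finset.filter_and]
    congr 2
    ext k
    simp
  have h2 : ∀ k : Fin n, ∑ j : Fin n, (if k ∈ N ∧ j = b then B else 1) =
      n * if k ∈ N then 1 + (B - 1) / n else 1 := fun k => by
    by_cases hk : k ∈ N
    · have : ∀ j : Fin n, (if j = b then B else 1) = 1 + if j = b then B - 1 else 0 := fun j => by
        split_ifs <;> ring
      simp [hk, this, Finset.sum_add_distrib]
      field_simp
    · simp [hk]
  have h3 := Finset.prod_univ_sum (fun _ : Fin n => (Finset.univ : Finset (Fin n)))
    (fun k j => if k ∈ N ∧ j = b then B else 1)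
  rw [Fintype.piFinset_univ] at h3
  simp only [average, h1]
  rw [← h3]
  simp only [h2, Finset.prod_mul_distrib, Finset.prod_const, Finset.card_univ, Fintype.card_fin]
  rw [mul_div_cancel_left₀ _ (pow_ne_zero _ hn), Finset.prod_ite]
  simp

theorem average_pow_card_le {n : ℕ} [NeZero n] {B : ℝ} (hB : 1 ≤ B) (N : Finset (Fin n))
    (b : Fin n) :
    average (fun f => B ^ (N.filter fun k => f k = b).card) ≤
      Real.exp ((B - 1) * (N.card / n)) := by
  rw [average_pow_card]
  have h0 : 0 ≤ (B - 1) / n := div_nonneg (by linarith) (by positivity)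
  calc (1 + (B - 1) / n) ^ N.card ≤ Real.exp ((B - 1) / n) ^ N.card := by
        gcongr
        rw [add_comm]
        exact Real.add_one_le_exp _
    _ = _ := by
        rw [← Real.exp_nat_mul]
        congr 1
        ring

theorem length_step {n : ℕ} (σ : Equiv.Perm (Fin n)) (f : Fin n → Fin n) (q : Queues n)
    (b : Fin n) :
    (step σ f q b).length = (q b).length - 1 + ((occupied q).filter fun k => f k = b).card := by
  simp [step, length_arrivals]

/-- Since `4097 = 17 * 241`, the right side equals `256/241 = 1 / (1 - 15/256)`, the standard bound
for the exponential. This is the origin of the contraction factor `4096/4097`. -/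
theorem exp_fifteen_le : Real.exp (15 / 256) ≤ 4096 / 4097 * (17 / 16) := by
  have := Real.exp_bound_div_one_sub_of_interval (x := 15 / 256) (by norm_num) (by norm_num)
  refine this.trans ?_
  norm_num

/-- While at least a fraction `1/16` of the bins is empty, the load of a bin has a negative
exponential drift. -/
theorem average_pow_length_step_le {n : ℕ} [NeZero n] (σ : (Fin n → Fin n) → Equiv.Perm (Fin n))
    {q : Queues n} (hq : 16 * (occupied q).card ≤ 15 * n) (b : Fin n) :
    average (fun f => (17 / 16 : ℝ) ^ (step (σ f) f q b).length) ≤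
      4096 / 4097 * (17 / 16) ^ (q b).length + 2 := by
  simp only [length_step, pow_add, average_const_mul]
  have hn : (0 : ℝ) < n := by exact_mod_cast NeZero.pos n
  have hocc : ((occupied q).card : ℝ) / n ≤ 15 / 16 := by
    rw [div_le_div_iff₀ hn (by norm_num)]
    exact_mod_cast (by omega : (occupied q).card * 16 ≤ 15 * n)
  have h1 : average (fun f => (17 / 16 : ℝ) ^ ((occupied q).filter fun k => f k = b).card) ≤
      4096 / 4097 * (17 / 16) :=
    ((average_pow_card_le (by norm_num) _ b).trans (Real.exp_le_exp.2 (by linarith))).trans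
      exp_fifteen_le
  rcases Nat.eq_zero_or_pos (q b).length with h0 | h0
  · simp only [h0]
    norm_num at h1 ⊢
    linarith
  · calc _ ≤ (17 / 16 : ℝ) ^ ((q b).length - 1) * (4096 / 4097 * (17 / 16)) := by gcongr
      _ = 4096 / 4097 * (17 / 16) ^ (q b).length := by
        obtain ⟨l, hl⟩ := Nat.exists_eq_add_of_lt h0
        simp only [hl, zero_add, Nat.add_sub_cancel, pow_succ]
        ring
      _ ≤ _ := by linarith

/-- Needed for round `0` only, where every bin may be occupied. The loss is a constant factor,
written so that it fits the later contraction. -/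
theorem average_pow_length_step_le_two {n : ℕ} [NeZero n]
    (σ : (Fin n → Fin n) → Equiv.Perm (Fin n)) (q : Queues n) (b : Fin n) :
    average (fun f => (17 / 16 : ℝ) ^ (step (σ f) f q b).length) ≤
      4096 / 4097 * (2 * (17 / 16) ^ (q b).length) := by
  simp only [length_step, pow_add, average_const_mul]
  have hn : (0 : ℝ) < n := by exact_mod_cast NeZero.pos n
  have hocc : ((occupied q).card : ℝ) / n ≤ 1 := by
    rw [div_le_one hn]
    exact_mod_cast (by simpa using Finset.card_le_univ (occupied q))
  have h1 : average (fun f => (17 / 16 : ℝ) ^ ((occupied q).filter fun k => f k = b).card) ≤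
      16 / 15 := by
    refine (average_pow_card_le (by norm_num) _ b).trans
      ((Real.exp_le_exp.2 (by linarith : _ ≤ (1 / 16 : ℝ))).trans ?_)
    refine (Real.exp_bound_div_one_sub_of_interval (x := 1 / 16) (by norm_num)
      (by norm_num)).trans ?_
    norm_num
  calc _ ≤ (17 / 16 : ℝ) ^ ((q b).length - 1) * (16 / 15) := by gcongr
    _ ≤ (17 / 16 : ℝ) ^ (q b).length * (16 / 15) := by
        gcongr
        · norm_num
        · exact Nat.sub_le _ _
    _ ≤ _ := by nlinarith [pow_pos (by norm_num : (0 : ℝ) < 17 / 16) (q b).length]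

theorem card_length_le_one {n : ℕ} {q : Queues n} (hq : IsConfiguration q) :
    n ≤ 2 * (Finset.univ.filter fun b => (q b).length ≤ 1).card := by
  have h1 : ∑ b, (2 - if (q b).length ≤ 1 then 2 else 0) ≤ ∑ b, (q b).length :=
    Finset.sum_le_sum fun b _ => by split_ifs <;> omega
  have h2 : ∑ b : Fin n, ((2 - if (q b).length ≤ 1 then 2 else 0) +
      if (q b).length ≤ 1 then 2 else 0) = n * 2 := by
    rw [Finset.sum_congr rfl fun b _ => by
      show _ = 2
      split_ifs <;> rfl]
    simp
  rw [hq.sum_length] at h1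
  rw [Finset.sum_add_distrib] at h2
  rw [Finset.card_filter, Finset.mul_sum]
  simp only [mul_ite, mul_one, mul_zero]
  omega

/-- A bin of load at most one is empty after the round unless hit. Removing the whole image of `f`,
ignored choices included, only weakens the bound and reduces it to `n` uniform throws. -/
theorem card_occupied_step_add_le {n : ℕ} (σ : Equiv.Perm (Fin n)) (f : Fin n → Fin n)
    (q : Queues n) :
    (occupied (step σ f q)).card +
      ((Finset.univ.filter fun b => (q b).length ≤ 1) \ Finset.univ.image f).card ≤ n := by
  rw [← Finset.card_union_of_disjoint]
  · simpa using Finset.card_le_univ (occupied (step σ f q) ∪ _)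
  · refine Finset.disjoint_left.2 fun b hb hb' => mem_occupied.1 hb ?_
    simp only [Finset.mem_sdiff, Finset.mem_filter, Finset.mem_univ, true_and, Finset.mem_image,
      not_exists] at hb'
    rw [← List.length_eq_zero_iff, length_step, Finset.filter_eq_empty_iff.2 fun k _ => hb'.2 k]
    simp [hb'.1]

/-- From any configuration, after one round at least a fraction `1/16` of the bins is empty, except
with exponentially small probability. -/
theorem average_card_occupied_le {n : ℕ} (hn : 2 ≤ n)
    (σ : (Fin n → Fin n) → Equiv.Perm (Fin n)) {q : Queues n} (hq : IsConfiguration q) :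
    average (fun f => if 15 * n < 16 * (occupied (step (σ f) f q)).card then 1 else 0) ≤
      Real.exp (-n / 160) := by
  have : NeZero n := ⟨by omega⟩
  have hn0 : (0 : ℝ) < n := by exact_mod_cast NeZero.pos n
  set S := Finset.univ.filter fun b => (q b).length ≤ 1 with hS
  have hSn : (n : ℝ) ≤ 2 * S.card := by exact_mod_cast card_length_le_one hq
  have hlog0 := Real.log_pos (by norm_num : (1 : ℝ) < 2)
  -- Exponential Markov with weight `1/2` per missed bin: on the bad event at most `n/16` bins of
  -- `S` are missed, so the prefactor `2 ^ (n/16)` compensates.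
  have h1 : average (fun f => if 15 * n < 16 * (occupied (step (σ f) f q)).card then 1 else 0) ≤
      average (fun f => Real.exp (n * Real.log 2 / 16) *
        (1 / 2 : ℝ) ^ (S \ Finset.univ.image f).card) := by
    refine average_mono fun f => ?_
    split_ifs with h
    · have h2 := card_occupied_step_add_le (σ f) f q
      have h3 : 16 * (S \ Finset.univ.image f).card ≤ n := by rw [← hS] at h2; omega
      have h4 : (16 : ℝ) * (S \ Finset.univ.image f).card ≤ n := by exact_mod_cast h3
      rw [show (1 / 2 : ℝ) = Real.exp (-Real.log 2) by
        rw [Real.exp_neg, Real.exp_log (by norm_num)]; norm_num, ← Real.exp_nat_mul,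
        ← Real.exp_add, Real.one_le_exp_iff]
      nlinarith
    · positivity
  refine h1.trans ?_
  rw [average_const_mul]
  have h2 : average (fun f => (1 / 2 : ℝ) ^ (S \ Finset.univ.image f).card) ≤
      (1 - (1 - 1 / 2) * (1 - 1 / n) ^ n) ^ S.card := by
    rw [average, div_le_iff₀' (by positivity)]
    exact sum_pow_card_sdiff_image_le (by norm_num) (by norm_num) n S
  have h3 := one_fifth_le_one_sub_inv_pow hn
  have h4 : ((1 - 1 / n) ^ n : ℝ) ≤ 1 := by
    have hn1 : (1 : ℝ) / n ≤ 1 := by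
      rw [div_le_one hn0]; exact_mod_cast NeZero.one_le
    exact pow_le_one₀ (by linarith) (by linarith [(by positivity : (0 : ℝ) < 1 / n)])
  calc _ ≤ Real.exp (n * Real.log 2 / 16) * Real.exp (-(1 / 10)) ^ S.card := by
        gcongr
        refine h2.trans ?_
        gcongr
        · linarith
        · linarith [Real.add_one_le_exp (-(1 / 10) : ℝ)]
    _ = Real.exp (n * Real.log 2 / 16 + S.card * (-(1 / 10))) := by
        rw [← Real.exp_nat_mul, ← Real.exp_add]
    -- As `S.card ≥ n/2`, the exponent is at most `n (log 2 / 16 - 1/20)`, just below `-n/160`.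
    _ ≤ _ := by
        rw [Real.exp_le_exp]
        nlinarith [Real.log_two_lt_d9]

/-! ### Maximum load over many rounds -/

section Load
variable {n : ℕ} (τ : TieBreak n) (q₀ : Queues n)

/-- Non-anticipation of the tie-breaking rule enters here. -/
theorem process_congr {t : ℕ} {ω ω' : Choices n} (h : ∀ s < t, ω s = ω' s) :
    process τ q₀ ω t = process τ q₀ ω' t := by
  induction t with
  | zero => rfl
  | succ t ih =>
    rw [process, process, ih fun s hs => h s (by omega), h t (by omega)]
    congr 2
    exact funext fun s => h s s.2

theorem process_update_of_le {r t : ℕ} (h : r ≤ t) (ω : Choices n) (f : Fin n → Fin n) :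
    process τ q₀ (Function.update ω t f) r = process τ q₀ ω r :=
  process_congr τ q₀ fun s hs => Function.update_of_ne (by omega) _ _

theorem process_update_succ (t : ℕ) (ω : Choices n) (f : Fin n → Fin n) :
    process τ q₀ (Function.update ω t f) (t + 1) =
      step (τ t fun s => Function.update ω t f s) f (process τ q₀ ω t) := by
  rw [process, process_update_of_le τ q₀ le_rfl, Function.update_self]

/-- In all rounds `1, …, t - 1` at least a fraction `1/16` of the bins is empty. -/
def SparseUntil (ω : Choices n) (t : ℕ) : Prop :=
  ∀ r, 1 ≤ r → r < t → 16 * (occupied (process τ q₀ ω r)).card ≤ 15 * n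

open Classical in
/-- The exponential potential of bin `b`, as long as the process is sparse. -/
noncomputable def potential (b : Fin n) (t : ℕ) (ω : Choices n) : ℝ :=
  if SparseUntil τ q₀ ω t then (17 / 16) ^ (process τ q₀ ω t b).length else 0

theorem potential_nonneg (b : Fin n) (t : ℕ) (ω : Choices n) : 0 ≤ potential τ q₀ b t ω := by
  unfold potential
  split_ifs <;> positivity

theorem sparseUntil_congr {t : ℕ} {ω ω' : Choices n} (h : ∀ r < t, process τ q₀ ω r =
    process τ q₀ ω' r) : SparseUntil τ q₀ ω t ↔ SparseUntil τ q₀ ω' t :=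
  forall₃_congr fun r _ hr => by rw [h r hr]

theorem dependsOn_potential (b : Fin n) (t : ℕ) :
    DependsOn (potential τ q₀ b t) (Set.Iio t) := by
  intro ω ω' h
  have h' : ∀ r ≤ t, process τ q₀ ω r = process τ q₀ ω' r := fun r hr =>
    process_congr τ q₀ fun s hs => h s (hs.trans_le hr)
  have hs : SparseUntil τ q₀ ω t ↔ SparseUntil τ q₀ ω' t :=
    sparseUntil_congr τ q₀ fun r hr => h' r hr.le
  rw [potential, potential, h' t le_rfl]
  classical exact if_congr hs rfl rfl

open Classical in
theorem potential_update_succ (b : Fin n) (t : ℕ) (ω : Choices n) (f : Fin n → Fin n) :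
    potential τ q₀ b (t + 1) (Function.update ω t f) =
      if SparseUntil τ q₀ ω (t + 1) then (17 / 16) ^
        (step (τ t fun s => Function.update ω t f s) f (process τ q₀ ω t) b).length else 0 := by
  simp only [potential, process_update_succ]
  rw [sparseUntil_congr τ q₀ fun r hr => process_update_of_le τ q₀ (Nat.lt_succ_iff.1 hr) ω f]

/-- The constant `8194 = 2 * 4097` is the fixed point of `x ↦ 4096/4097 * x + 2`; the factor `2`
pays for round `0`, which sparsity does not cover. -/
theorem integral_potential_le [NeZero n] (b : Fin n) (t : ℕ) :
    ∫ ω, potential τ q₀ b t ω ∂law n ≤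
      2 * (4096 / 4097) ^ t * (17 / 16) ^ (q₀ b).length + 8194 := by
  have h0 : ∀ ω, potential τ q₀ b 0 ω = (17 / 16) ^ (q₀ b).length := fun ω => by
    simp [potential, SparseUntil, process]
  have hpos : (0 : ℝ) < (17 / 16) ^ (q₀ b).length := by positivity
  cases t with
  | zero =>
    simp only [h0, integral_const, probReal_univ, one_smul]
    linarith
  | succ t =>
    induction t with
    | zero =>
      have := integral_le_of_average_le (dependsOn_potential τ q₀ b 0)
        (dependsOn_potential τ q₀ b 1) (a := 4096 / 4097 * 2) (d := 0) fun ω => by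
          rw [h0]
          refine (average_mono (G := fun f => (17 / 16 : ℝ) ^ (step (τ 0 fun s =>
            Function.update ω 0 f s) f (process τ q₀ ω 0) b).length) fun f => ?_).trans ?_
          · rw [potential_update_succ]
            split_ifs
            · exact le_rfl
            · positivity
          · have := average_pow_length_step_le_two (fun f => τ 0 fun s => Function.update ω 0 f s)
              (process τ q₀ ω 0) b
            rw [show process τ q₀ ω 0 = q₀ from rfl] at this ⊢
            linarith
      simp only [h0, integral_const, probReal_univ, one_smul] at this
      rw [zero_add]
      linarith
    | succ t ih =>
      have := integral_le_of_average_le (dependsOn_potential τ q₀ b (t + 1))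
        (dependsOn_potential τ q₀ b (t + 1 + 1)) (a := 4096 / 4097) (d := 2) fun ω => by
          simp only [potential_update_succ]
          split_ifs with h
          · have h' : SparseUntil τ q₀ ω (t + 1) := fun r h1 h2 => h r h1 (by omega)
            rw [potential, if_pos h']
            exact average_pow_length_step_le _ (h (t + 1) (by omega) (by omega)) b
          · rw [average_const]
            linarith [potential_nonneg τ q₀ b (t + 1) ω]
      calc _ ≤ _ := this
        _ ≤ 4096 / 4097 * (2 * (4096 / 4097) ^ (t + 1) * (17 / 16) ^ (q₀ b).length + 8194) + 2 := by
            gcongr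
        _ = _ := by ring

theorem law_not_sparse_le {q₀ : Queues n} (hn : 2 ≤ n) (hq : IsConfiguration q₀) (t : ℕ) :
    (law n).real {ω | 15 * n < 16 * (occupied (process τ q₀ ω (t + 1))).card} ≤
      Real.exp (-n / 160) := by
  have : NeZero n := ⟨by omega⟩
  have hd : DependsOn (fun ω : Choices n =>
      if 15 * n < 16 * (occupied (process τ q₀ ω (t + 1))).card then (1 : ℝ) else 0)
      (Set.Iio (t + 1)) := fun ω ω' h => by
    simp only [process_congr τ q₀ fun s hs => h s hs]
  refine (measure_le_of_le hd (fun ω => by positivity) one_pos fun ω hω => ?_).trans ?_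
  · rw [if_pos (show 15 * n < 16 * (occupied (process τ q₀ ω (t + 1))).card from hω)]
  -- The one-round bound is uniform in the past, so only the additive term of the drift inequality
  -- is used.
  · have := integral_le_of_average_le (g := fun _ => 0) (t := t) (a := 0)
      (d := Real.exp (-n / 160)) (fun _ _ _ => rfl) hd fun ω => by
        simp only [process_update_succ]
        have := average_card_occupied_le hn (fun f => τ t fun s => Function.update ω t f s)
          (isConfiguration_process τ hq ω t)
        linarith
    linarith

theorem law_load_le [NeZero n] (b : Fin n) (t M : ℕ) :
    (law n).real {ω | SparseUntil τ q₀ ω t ∧ M < (process τ q₀ ω t b).length} ≤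
      (2 * (4096 / 4097) ^ t * (17 / 16) ^ (q₀ b).length + 8194) / (17 / 16) ^ M := by
  refine (measure_le_of_le (dependsOn_potential τ q₀ b t) (potential_nonneg τ q₀ b t)
    (a := (17 / 16) ^ M) (by positivity) fun ω hω => ?_).trans ?_
  · rw [potential, if_pos hω.1]
    exact pow_le_pow_right₀ (by norm_num) hω.2.le
  · gcongr
    exact integral_potential_le τ q₀ b t

theorem law_maxLoad_le {q₀ : Queues n} (hn : 2 ≤ n) (hq : IsConfiguration q₀) (r₀ H M : ℕ)
    {X : ℝ} (hX : 1 ≤ X) (hr₀ : ∀ b, (4096 / 4097 : ℝ) ^ r₀ * (17 / 16) ^ (q₀ b).length ≤ X) :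
    (law n).real {ω | ∃ r, r₀ ≤ r ∧ r ≤ H ∧ M < maxLoad (process τ q₀ ω r)} ≤
      H * Real.exp (-n / 160) + (H + 1) * (n * (8196 * X / (17 / 16) ^ M)) := by
  have : NeZero n := ⟨by omega⟩
  set E₁ : ℕ → Set (Choices n) := fun t =>
    {ω | 15 * n < 16 * (occupied (process τ q₀ ω (t + 1))).card}
  set E₂ : ℕ → Fin n → Set (Choices n) := fun r b =>
    {ω | SparseUntil τ q₀ ω r ∧ r₀ ≤ r ∧ M < (process τ q₀ ω r b).length}
  have hsub : {ω | ∃ r, r₀ ≤ r ∧ r ≤ H ∧ M < maxLoad (process τ q₀ ω r)} ⊆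
      (⋃ t ∈ Finset.range H, E₁ t) ∪
        ⋃ r ∈ Finset.range (H + 1), ⋃ b ∈ (Finset.univ : Finset (Fin n)), E₂ r b := by
    rintro ω ⟨r, hr, hrH, hM⟩
    by_cases hs : SparseUntil τ q₀ ω r
    · right
      obtain ⟨b, -, hb⟩ := Finset.lt_sup_iff.1 hM
      simp only [Set.mem_iUnion]
      exact ⟨r, by simpa using Nat.lt_succ_of_le hrH, b, Finset.mem_univ b, hs, hr, hb⟩
    · left
      simp only [SparseUntil, not_forall, not_le] at hs
      obtain ⟨s, hs1, hsr, hs⟩ := hs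
      simp only [Set.mem_iUnion]
      refine ⟨s - 1, Finset.mem_range.2 (by omega), ?_⟩
      simpa only [E₁, Set.mem_ofPred_eq, Nat.sub_add_cancel hs1] using hs
  have hE₂ : ∀ r b, (law n).real (E₂ r b) ≤ 8196 * X / (17 / 16) ^ M := fun r b => by
    by_cases hr : r₀ ≤ r
    · refine le_trans ?_ ((law_load_le τ q₀ b r M).trans ?_)
      · simp only [E₂, hr, true_and]
        exact le_rfl
      · gcongr
        have : (4096 / 4097 : ℝ) ^ r * (17 / 16) ^ (q₀ b).length ≤ X :=
          le_trans (by
            gcongr ?_ * _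
            exact pow_le_pow_of_le_one (by norm_num) (by norm_num) hr) (hr₀ b)
        nlinarith
    · simp only [E₂, hr, false_and, and_false, Set.ofPred_false, measureReal_empty]
      positivity
  refine (measureReal_mono hsub (measure_ne_top _ _)).trans ((measureReal_union_le _ _).trans ?_)
  gcongr
  · refine (measureReal_biUnion_finset_le _ _).trans ?_
    refine (Finset.sum_le_sum fun t _ => law_not_sparse_le τ hn hq t).trans ?_
    simp
  · refine (measureReal_biUnion_finset_le _ _).trans ?_
    refine (Finset.sum_le_sum fun r _ => (measureReal_biUnion_finset_le _ _).trans
      (Finset.sum_le_sum fun b _ => hE₂ r b)).trans ?_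
    simp

end Load

/-! ### A ball avoiding a fixed bin -/

section Cover
variable {n : ℕ} (τ : TieBreak n) (q₀ : Queues n)

theorem mem_step_of_head? (σ : Equiv.Perm (Fin n)) (f : Fin n → Fin n) {q : Queues n}
    {i k : Fin n} (h : (q k).head? = some i) : i ∈ step σ f q (f k) := by
  refine List.mem_append_right _ (List.mem_filterMap.2 ⟨σ.symm k, List.mem_finRange _, ?_⟩)
  simp [h]

theorem progress_succ_of_selected {ω : Choices n} {i : Fin n} {t : ℕ}
    (h : Selected τ q₀ ω i t) : progress τ q₀ ω i 0 (t + 1) = progress τ q₀ ω i 0 t + 1 := by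
  rw [progress_add]
  simp [progress, Finset.filter_singleton, h]

theorem progress_succ_of_not_selected {ω : Choices n} {i : Fin n} {t : ℕ}
    (h : ¬ Selected τ q₀ ω i t) : progress τ q₀ ω i 0 (t + 1) = progress τ q₀ ω i 0 t := by
  rw [progress_add]
  simp [progress, Finset.filter_singleton, h]

theorem progress_congr {ω ω' : Choices n} {t : ℕ}
    (h : ∀ r < t, process τ q₀ ω r = process τ q₀ ω' r) (i : Fin n) :
    progress τ q₀ ω i 0 t = progress τ q₀ ω' i 0 t := by
  classical
  unfold progress
  congr 1
  refine Finset.filter_congr fun r hr => ?_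
  simp only [Finset.mem_Ico] at hr
  rw [Selected, Selected, h r (by omega)]

/-- Ball `i` has not visited bin `b` within the first `t` rounds. -/
def Unvisited (i b : Fin n) (t : ℕ) (ω : Choices n) : Prop :=
  ∀ s ≤ t, i ∉ process τ q₀ ω s b

theorem unvisited_congr {ω ω' : Choices n} {t : ℕ}
    (h : ∀ r ≤ t, process τ q₀ ω r = process τ q₀ ω' r) (i b : Fin n) :
    Unvisited τ q₀ i b t ω ↔ Unvisited τ q₀ i b t ω' :=
  forall₂_congr fun s hs => by rw [h s hs]

open Classical in
/-- A nonnegative supermartingale which grows with the progress of ball `i` as long as it has not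
visited bin `b`. -/
noncomputable def avoidance (i b : Fin n) (t : ℕ) (ω : Choices n) : ℝ :=
  if Unvisited τ q₀ i b t ω then ((1 - 1 / n : ℝ)⁻¹) ^ progress τ q₀ ω i 0 t else 0

theorem dependsOn_avoidance (i b : Fin n) (t : ℕ) :
    DependsOn (avoidance τ q₀ i b t) (Set.Iio t) := by
  intro ω ω' h
  have h' : ∀ r ≤ t, process τ q₀ ω r = process τ q₀ ω' r := fun r hr =>
    process_congr τ q₀ fun s hs => h s (hs.trans_le hr)
  have hu : Unvisited τ q₀ i b t ω ↔ Unvisited τ q₀ i b t ω' := unvisited_congr τ q₀ h' i b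
  have hp : progress τ q₀ ω i 0 t = progress τ q₀ ω' i 0 t :=
    progress_congr τ q₀ (fun r hr => h' r hr.le) i
  rw [avoidance, avoidance, hp]
  classical exact if_congr hu rfl rfl

theorem one_sub_inv_pos (hn : 2 ≤ n) : (0 : ℝ) < 1 - 1 / n := by
  have : (2 : ℝ) ≤ n := by exact_mod_cast hn
  rw [sub_pos, div_lt_one (by linarith)]
  linarith

theorem average_avoidance_le (hn : 2 ≤ n) (i b : Fin n) (t : ℕ) (ω : Choices n) :
    average (fun f => avoidance τ q₀ i b (t + 1) (Function.update ω t f)) ≤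
      avoidance τ q₀ i b t ω := by
  classical
  have : NeZero n := ⟨by omega⟩
  have ha := one_sub_inv_pos hn
  have hup : ∀ f, ∀ r ≤ t, process τ q₀ (Function.update ω t f) r = process τ q₀ ω r :=
    fun f r hr => process_update_of_le τ q₀ hr ω f
  have hprog : ∀ f, progress τ q₀ (Function.update ω t f) i 0 t = progress τ q₀ ω i 0 t :=
    fun f => progress_congr τ q₀ (fun r hr => hup f r hr.le) i
  have hsel : ∀ f, Selected τ q₀ (Function.update ω t f) i t ↔ Selected τ q₀ ω i t :=
    fun f => by rw [Selected, Selected, hup f t le_rfl]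
  have hmono : ∀ f, Unvisited τ q₀ i b (t + 1) (Function.update ω t f) →
      Unvisited τ q₀ i b t ω := fun f h =>
    (unvisited_congr τ q₀ (hup f) i b).1 fun s hs => h s (by omega)
  by_cases hu : Unvisited τ q₀ i b t ω
  · rw [avoidance, if_pos hu]
    by_cases hs : Selected τ q₀ ω i t
    · obtain ⟨k, hk⟩ := hs
      -- The power of `0` is the indicator of `f k ≠ b`, so `average_pow_card` with `B = 0` gives
      -- the factor `1 - 1/n` that cancels the growth.
      calc _ ≤ average (fun f => (((1 - 1 / n : ℝ)⁻¹) ^ progress τ q₀ ω i 0 t *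
              (1 - 1 / n : ℝ)⁻¹) * 0 ^ (({k} : Finset (Fin n)).filter fun j => f j = b).card) := by
            refine average_mono fun f => ?_
            rw [avoidance]
            split_ifs with h
            · have hf : f k ≠ b := by
                rintro rfl
                refine h (t + 1) le_rfl ?_
                rw [process_update_succ]
                exact mem_step_of_head? _ f hk
              rw [progress_succ_of_selected τ q₀ ((hsel f).2 ⟨k, hk⟩), hprog, pow_succ,
                Finset.filter_singleton, if_neg hf]
              simp
            · positivity
        _ = _ := by
            rw [average_const_mul, average_pow_card, Finset.card_singleton, pow_one,
              show (1 + (0 - 1) / n : ℝ) = 1 - 1 / n by ring, mul_assoc,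
              inv_mul_cancel₀ ha.ne', mul_one]
    · refine (average_mono (G := fun _ => ((1 - 1 / n : ℝ)⁻¹) ^ progress τ q₀ ω i 0 t)
        fun f => ?_).trans_eq (average_const _)
      rw [avoidance]
      split_ifs with h
      · rw [progress_succ_of_not_selected τ q₀ (mt (hsel f).1 hs), hprog]
      · positivity
  · have h0 : ∀ f, avoidance τ q₀ i b (t + 1) (Function.update ω t f) = 0 := fun f => by
      rw [avoidance, if_neg fun h => hu (hmono f h)]
    simp only [h0]
    rw [average_const, avoidance, if_neg hu]

theorem integral_avoidance_le (hn : 2 ≤ n) (i b : Fin n) (t : ℕ) :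
    ∫ ω, avoidance τ q₀ i b t ω ∂law n ≤ 1 := by
  have : NeZero n := ⟨by omega⟩
  induction t with
  | zero =>
    have h0 : ∀ ω, avoidance τ q₀ i b 0 ω ≤ 1 := fun ω => by
      rw [avoidance]
      split_ifs
      · simp [progress]
      · exact zero_le_one
    refine (integral_mono (integrable_of_dependsOn (dependsOn_avoidance τ q₀ i b 0))
      (integrable_const 1) h0).trans ?_
    simp
  | succ t ih =>
    have := integral_le_of_average_le (dependsOn_avoidance τ q₀ i b t)
      (dependsOn_avoidance τ q₀ i b (t + 1)) (a := 1) (d := 0) fun ω => by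
        linarith [average_avoidance_le τ q₀ hn i b t ω]
    linarith

theorem law_unvisited_le (hn : 2 ≤ n) (i b : Fin n) (t m : ℕ) :
    (law n).real {ω | Unvisited τ q₀ i b t ω ∧ m ≤ progress τ q₀ ω i 0 t} ≤
      (1 - 1 / n) ^ m := by
  have : NeZero n := ⟨by omega⟩
  have ha := one_sub_inv_pos hn
  have ha1 : (1 - 1 / n : ℝ) ≤ 1 := by
    linarith [(by positivity : (0 : ℝ) ≤ 1 / n)]
  refine (measure_le_of_le (dependsOn_avoidance τ q₀ i b t) (fun ω => ?_)
    (a := ((1 - 1 / n : ℝ)⁻¹) ^ m) (by positivity) fun ω hω => ?_).trans ?_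
  · rw [avoidance]
    split_ifs <;> positivity
  · rw [avoidance, if_pos hω.1]
    exact pow_le_pow_right₀ ((one_le_inv₀ ha).2 ha1) hω.2
  · rw [inv_pow, div_inv_eq_mul]
    exact mul_le_of_le_one_left (by positivity) (integral_avoidance_le τ q₀ hn i b t)

end Cover

/-! ### High-probability statements and choice of constants -/

theorem half_le_log {n : ℕ} (hn : 2 ≤ n) : (1 / 2 : ℝ) ≤ Real.log n := by
  have h2 : (2 : ℝ) ≤ n := by exact_mod_cast hn
  linarith [Real.log_two_gt_d9, Real.log_le_log (by norm_num) h2]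

/-- Subadditivity alone is used, so neither event has to be shown measurable. -/
theorem one_sub_le_law {n : ℕ} [NeZero n] {S T : Set (Choices n)} (h : ∀ ω, ω ∉ T → ω ∈ S)
    {δ : ℝ} (hT : (law n).real T ≤ δ) : 1 - δ ≤ (law n).real S := by
  have h1 : (law n).real Set.univ ≤ (law n).real S + (law n).real T :=
    (measureReal_mono (fun ω _ => by
      by_cases hω : ω ∈ T
      · exact Or.inr hω
      · exact Or.inl (h ω hω)) (measure_ne_top _ _)).trans (measureReal_union_le S T)
  rw [probReal_univ] at h1
  linarith

theorem exists_pow_mul_exp_le (c : ℕ) (γ : ℝ) : ∃ n₀ : ℕ, ∀ n : ℕ, n₀ ≤ n → 2 ≤ n →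
    (n : ℝ) ^ c * Real.exp (-n / 160) ≤ (n : ℝ) ^ (-γ) / 2 := by
  have h := (tendsto_rpow_mul_exp_neg_mul_atTop_nhds_zero (c + γ) (1 / 160) (by norm_num)).comp
    tendsto_natCast_atTop_atTop
  obtain ⟨n₀, hn₀⟩ := Filter.eventually_atTop.1 (h.eventually_le_const
    (by norm_num : (0 : ℝ) < 1 / 2))
  refine ⟨n₀, fun n hn hn2 => ?_⟩
  have h1 := hn₀ n hn
  have hn0 : (0 : ℝ) < n := by exact_mod_cast (by omega : 0 < n)
  simp only [Function.comp_apply] at h1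
  rw [Real.rpow_add hn0, Real.rpow_natCast] at h1
  rw [Real.rpow_neg hn0.le, show (-n / 160 : ℝ) = -(1 / 160) * n by ring]
  have hg : (0 : ℝ) < (n : ℝ) ^ γ := by positivity
  rw [inv_eq_one_div, div_div, le_div_iff₀ (by positivity)]
  linarith

/-- The maximum load stays logarithmic for polynomially many rounds, with high probability, as soon
as the initial potential has decayed to a polynomial. -/
theorem exists_law_maxLoad_le (c : ℕ) (γ κ : ℝ) (hγ : 0 < γ) (hκ : 0 ≤ κ) : ∃ C : ℝ, 0 < C ∧
    ∀ n : ℕ, 2 ≤ n → ∀ (τ : TieBreak n) (q₀ : Queues n), IsConfiguration q₀ → ∀ r₀ : ℕ,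
      (∀ b, (4096 / 4097 : ℝ) ^ r₀ * (17 / 16) ^ (q₀ b).length ≤ (n : ℝ) ^ κ) →
      (law n).real {ω | ∃ r, r₀ ≤ r ∧ r ≤ n ^ c ∧
        ⌈C * Real.log n⌉₊ < maxLoad (process τ q₀ ω r)} ≤ (n : ℝ) ^ (-γ) := by
  obtain ⟨n₀, hn₀⟩ := exists_pow_mul_exp_le c γ
  have hB : 0 < Real.log (17 / 16) := Real.log_pos (by norm_num)
  -- In the exponent, `c` and `1` pay for the union over rounds and bins, `κ` for the initial
  -- potential, and `16` for numerical constants, as `n ^ 16 ≥ 65536`. The term `2 * n₀` settles `n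
  -- < n₀`: as `log n ≥ 1/2`, the threshold then exceeds `n` and the event is empty.
  set C : ℝ := 2 * n₀ + (c + κ + γ + 17) / Real.log (17 / 16) with hC
  have hC0 : 0 < (c + κ + γ + 17) / Real.log (17 / 16) := by positivity
  refine ⟨C, by positivity, fun n hn τ q₀ hq r₀ hr₀ => ?_⟩
  have hlog := half_le_log hn
  have hn0 : (0 : ℝ) < n := by exact_mod_cast (by omega : 0 < n)
  have hn2 : (2 : ℝ) ≤ n := by exact_mod_cast hn
  rcases lt_or_ge n n₀ with hlt | hge
  · convert Real.rpow_nonneg hn0.le (-γ)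
    convert measureReal_empty
    ext ω
    simp only [Set.mem_ofPred_eq, Set.mem_empty_iff_false, iff_false, not_exists, not_and, not_lt]
    intro r _ _
    have h1 : maxLoad (process τ q₀ ω r) ≤ n :=
      Finset.sup_le fun b _ => (isConfiguration_process τ hq ω r).length_le b
    have h2 : (n : ℝ) ≤ C * Real.log n := by
      have : (n : ℝ) ≤ n₀ := by exact_mod_cast hlt.le
      have h3 : 2 * n₀ ≤ C := by linarith
      nlinarith
    exact_mod_cast ((by exact_mod_cast h1 : ((maxLoad (process τ q₀ ω r) : ℕ) : ℝ) ≤ n).trans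
      h2).trans (Nat.le_ceil _)
  · have hX : (1 : ℝ) ≤ (n : ℝ) ^ κ := Real.one_le_rpow (by linarith) hκ
    refine (law_maxLoad_le τ hn hq r₀ (n ^ c) ⌈C * Real.log n⌉₊ hX hr₀).trans ?_
    have hM : (n : ℝ) ^ (c + κ + γ + 17) ≤ (17 / 16) ^ ⌈C * Real.log n⌉₊ := by
      rw [← Real.rpow_natCast, Real.rpow_def_of_pos hn0, Real.rpow_def_of_pos (by norm_num),
        Real.exp_le_exp]
      calc Real.log n * (c + κ + γ + 17)
          = Real.log (17 / 16) * ((c + κ + γ + 17) / Real.log (17 / 16) * Real.log n) := by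
            field_simp
        _ ≤ Real.log (17 / 16) * (C * Real.log n) := by
            gcongr
            linarith
        _ ≤ _ := by
            gcongr
            exact Nat.le_ceil _
    have h2 : ((n : ℝ) ^ c + 1) * (n * (8196 * (n : ℝ) ^ κ / (17 / 16) ^ ⌈C * Real.log n⌉₊)) ≤
        (n : ℝ) ^ (-γ) / 2 := by
      have hnc : (1 : ℝ) ≤ (n : ℝ) ^ c := one_le_pow₀ (by linarith)
      have h16 : (65536 : ℝ) ≤ (n : ℝ) ^ 16 := by
        calc (65536 : ℝ) = 2 ^ 16 := by norm_num
          _ ≤ _ := by gcongr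
      have hsplit : (n : ℝ) ^ (c + κ + γ + 17) =
          (n : ℝ) ^ c * (n : ℝ) ^ κ * (n : ℝ) ^ γ * ((n : ℝ) ^ 16 * n) := by
        rw [show (c + κ + γ + 17 : ℝ) = c + κ + γ + (16 : ℕ) + 1 by push_cast; ring,
          Real.rpow_add hn0, Real.rpow_add hn0, Real.rpow_add hn0, Real.rpow_add hn0,
          Real.rpow_one, Real.rpow_natCast, Real.rpow_natCast]
        ring
      have hγ0 : (0 : ℝ) < (n : ℝ) ^ γ := by positivity
      have hκ0 : (0 : ℝ) < (n : ℝ) ^ κ := by positivity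
      calc _ ≤ ((n : ℝ) ^ c + (n : ℝ) ^ c) *
            (n * (8196 * (n : ℝ) ^ κ / (n : ℝ) ^ (c + κ + γ + 17))) := by gcongr
        _ = 16392 / ((n : ℝ) ^ γ * (n : ℝ) ^ 16) := by
            rw [hsplit]
            field_simp
            norm_num
        _ ≤ 16392 / ((n : ℝ) ^ γ * 65536) := by gcongr
        _ ≤ _ := by
            rw [Real.rpow_neg hn0.le, div_le_iff₀ (by positivity)]
            field_simp
            norm_num
    have h1 := hn₀ n hge hn
    push_cast
    linarith

/-- The ceiling costs at most `1 ≤ 2 log n`, hence `C + 2`; rounding `t / M` down costs a factor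
`2`, because `t ≥ M`. -/
theorem le_progress_of_maxLoad_le {n : ℕ} (hn : 2 ≤ n) (τ : TieBreak n) {q₀ : Queues n}
    (hq : IsConfiguration q₀) (ω : Choices n) (i : Fin n) (s t : ℕ) {C C' : ℝ} (hC : 0 < C)
    (hC' : 2 * (C + 2) ≤ C') (ht : C' * Real.log n ≤ t)
    (h : ∀ r, s ≤ r → r < s + t → maxLoad (process τ q₀ ω r) ≤ ⌈C * Real.log n⌉₊) :
    (t : ℝ) / (C' * Real.log n) ≤ progress τ q₀ ω i s t := by
  have hlog := half_le_log hn
  set M := ⌈C * Real.log n⌉₊ with hM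
  have hM0 : 0 < M := Nat.ceil_pos.2 (by positivity)
  have hM1 : (M : ℝ) ≤ (C + 2) * Real.log n := by
    have := Nat.ceil_lt_add_one (a := C * Real.log n) (by positivity)
    nlinarith
  have hMt : 2 * (M : ℝ) ≤ C' * Real.log n := by nlinarith
  have hM0' : (0 : ℝ) < M := by exact_mod_cast hM0
  have hMt' : M ≤ t := by exact_mod_cast (by linarith : (M : ℝ) ≤ t)
  have hk : t / M ≤ progress τ q₀ ω i s t :=
    (le_progress_mul τ hq ω i s (t / M) M hM0 fun r h1 h2 =>
      h r h1 (h2.trans_le (Nat.add_le_add_left (Nat.div_mul_le_self t M) s))).trans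
      (progress_mono τ q₀ ω i s (Nat.div_mul_le_self t M))
  have hk1 : 1 ≤ t / M := (Nat.one_le_div_iff hM0).2 hMt'
  have hlt : t ≤ 2 * (t / M) * M := by
    have := Nat.lt_div_mul_add (a := t) hM0
    nlinarith
  have hlt' : (t : ℝ) ≤ 2 * ((t / M : ℕ) : ℝ) * M := by exact_mod_cast hlt
  calc (t : ℝ) / (C' * Real.log n) ≤ ((t / M : ℕ) : ℝ) := by
        rw [div_le_iff₀ (by linarith)]
        nlinarith [(Nat.cast_nonneg (t / M) : (0 : ℝ) ≤ ((t / M : ℕ) : ℝ))]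
    _ ≤ _ := by exact_mod_cast hk

theorem exists_progress_of_isLegitimate (γ : ℝ) (hγ : 0 < γ) (c : ℕ) (K : ℝ) :
    ∃ C : ℝ, 0 < C ∧ ∀ n : ℕ, 2 ≤ n → ∀ (τ : TieBreak n) (q₀ : Queues n),
      IsConfiguration q₀ → IsLegitimate K q₀ → 1 - (n : ℝ) ^ (-γ) ≤ (law n).real
        {ω | ∀ s t : ℕ, s + t ≤ n ^ c → C * Real.log n ≤ t → ∀ i : Fin n,
          (t : ℝ) / (C * Real.log n) ≤ progress τ q₀ ω i s t} := by
  have hB : 0 < Real.log (17 / 16) := Real.log_pos (by norm_num)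
  -- This exponent turns `(17/16) ^ (K log n)` into a power of `n`; the maximum covers negative `K`.
  obtain ⟨C, hC, h⟩ := exists_law_maxLoad_le c γ (max K 0 * Real.log (17 / 16)) hγ (by positivity)
  refine ⟨2 * (C + 2), by positivity, fun n hn τ q₀ hq hK => ?_⟩
  have : NeZero n := ⟨by omega⟩
  have hn0 : (0 : ℝ) < n := by exact_mod_cast (by omega : 0 < n)
  refine one_sub_le_law (fun ω hω s t hst ht i => ?_) (h n hn τ q₀ hq 0 fun b => ?_)
  · refine le_progress_of_maxLoad_le hn τ hq ω i s t hC le_rfl ht fun r _ hr => ?_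
    by_contra! hlt
    exact hω ⟨r, Nat.zero_le r, by omega, hlt⟩
  · rw [pow_zero, one_mul, ← Real.rpow_natCast, Real.rpow_def_of_pos hn0,
      Real.rpow_def_of_pos (by norm_num), Real.exp_le_exp]
    have h1 : ((q₀ b).length : ℝ) ≤ max K 0 * Real.log n :=
      calc ((q₀ b).length : ℝ) ≤ maxLoad q₀ := by exact_mod_cast length_le_maxLoad q₀ b
        _ ≤ K * Real.log n := hK
        _ ≤ _ := by
          gcongr
          exact le_max_left _ _
    calc _ ≤ Real.log (17 / 16) * (max K 0 * Real.log n) := by gcongr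
      _ = _ := by ring

theorem exists_progress (γ : ℝ) (hγ : 0 < γ) (c : ℕ) :
    ∃ C : ℝ, 0 < C ∧ ∀ n : ℕ, 2 ≤ n → ∀ (τ : TieBreak n) (q₀ : Queues n),
      IsConfiguration q₀ → 1 - (n : ℝ) ^ (-γ) ≤ (law n).real
        {ω | ∀ s t : ℕ, s + t ≤ n ^ c → C * n ≤ t → ∀ i : Fin n,
          (t : ℝ) / (C * Real.log n) ≤ progress τ q₀ ω i s t} := by
  obtain ⟨C, hC, h⟩ := exists_law_maxLoad_le c γ 0 hγ le_rfl
  -- The first `256 n` rounds of the window are discarded, so the rest lies after the warm-up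
  -- wherever the window starts. The summand `512` makes the discarded part at most half of `t`,
  -- which costs another factor `2`.
  refine ⟨2 * (2 * (C + 2)) + 512, by positivity, fun n hn τ q₀ hq => ?_⟩
  have : NeZero n := ⟨by omega⟩
  have hn0 : (0 : ℝ) < n := by exact_mod_cast (by omega : 0 < n)
  have hlog := half_le_log hn
  have hlogn : Real.log n ≤ n := Real.log_le_self hn0.le
  refine one_sub_le_law (fun ω hω s t hst ht i => ?_) (h n hn τ q₀ hq (256 * n) fun b => ?_)
  · have ht1 : (512 * n : ℝ) ≤ t := by nlinarith
    have ht2 : 512 * n ≤ t := by exact_mod_cast ht1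
    have hsplit : t = 256 * n + (t - 256 * n) := by omega
    have ht3 : ((t - 256 * n : ℕ) : ℝ) = t - 256 * n := by
      rw [Nat.cast_sub (by omega)]
      push_cast
      ring
    have hp := le_progress_of_maxLoad_le hn τ hq ω i (s + 256 * n) (t - 256 * n) hC
      le_rfl (by rw [ht3]; nlinarith) fun r h1 h2 => by
        by_contra! hlt
        exact hω ⟨r, by omega, by omega, hlt⟩
    have hle : progress τ q₀ ω i (s + 256 * n) (t - 256 * n) ≤ progress τ q₀ ω i s t := by
      conv_rhs => rw [hsplit, progress_add]
      omega
    calc (t : ℝ) / ((2 * (2 * (C + 2)) + 512) * Real.log n)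
        ≤ ((t - 256 * n : ℕ) : ℝ) / (2 * (C + 2) * Real.log n) := by
          rw [div_le_div_iff₀ (by positivity) (by positivity), ht3]
          have h5 : (t : ℝ) * (2 * (C + 2)) ≤ (t - 256 * n) * (2 * (2 * (C + 2)) + 512) := by
            nlinarith
          have h6 := mul_le_mul_of_nonneg_right h5 (by linarith : 0 ≤ Real.log n)
          linarith
      _ ≤ _ := hp
      _ ≤ _ := by exact_mod_cast hle
  · have h1 : (4096 / 4097 : ℝ) ^ 256 * (17 / 16) ≤ 1 := by norm_num
    calc (4096 / 4097 : ℝ) ^ (256 * n) * (17 / 16) ^ (q₀ b).length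
        ≤ (4096 / 4097 : ℝ) ^ (256 * n) * (17 / 16) ^ n := by
          gcongr
          · norm_num
          · exact hq.length_le b
      _ = ((4096 / 4097 : ℝ) ^ 256 * (17 / 16)) ^ n := by rw [pow_mul, mul_pow]
      _ ≤ 1 := pow_le_one₀ (by positivity) h1
      _ = _ := (Real.rpow_zero _).symm

theorem rpow_neg_add_one_le_half {n : ℕ} (hn : 2 ≤ n) (γ : ℝ) :
    (n : ℝ) ^ (-(γ + 1)) ≤ (n : ℝ) ^ (-γ) / 2 := by
  have hn2 : (2 : ℝ) ≤ n := by exact_mod_cast hn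
  rw [neg_add, Real.rpow_add (by linarith), Real.rpow_neg_one, div_eq_mul_inv]
  gcongr

/-- Within `O(n log² n)` rounds every ball makes a prescribed multiple of `n log n` moves. -/
theorem exists_progress_ge (γ A : ℝ) (hγ : 0 < γ) (hA : 0 < A) :
    ∃ C : ℝ, 0 < C ∧ ∀ n : ℕ, 2 ≤ n → ∀ (τ : TieBreak n) (q₀ : Queues n), IsConfiguration q₀ →
      ∃ T : ℕ, (T : ℝ) ≤ C * n * Real.log n ^ 2 ∧ 1 - (n : ℝ) ^ (-γ) ≤ (law n).real
        {ω | ∀ i : Fin n, ⌈A * n * Real.log n⌉₊ ≤ progress τ q₀ ω i 0 T} := by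
  -- Horizon `n ^ 4` suffices once `n ≥ D`, as then `D n log² n ≤ n * n * n ^ 2`. For `n < D` the
  -- trivial load bound `n` gives the progress deterministically.
  obtain ⟨C, hC, h⟩ := exists_progress γ hγ 4
  set D : ℝ := C * (A + 1) + 4 * C + 8 with hD
  have hD0 : 0 < D := by positivity
  refine ⟨D + 2 * D * (A + 1), by positivity, fun n hn τ q₀ hq => ?_⟩
  have : NeZero n := ⟨by omega⟩
  have hn2 : (2 : ℝ) ≤ n := by exact_mod_cast hn
  have hlog := half_le_log hn
  have hlogn : Real.log n ≤ n := Real.log_le_self (by linarith)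
  have hlog2 : 1 / 4 ≤ Real.log n ^ 2 := by nlinarith
  have hm : (⌈A * n * Real.log n⌉₊ : ℝ) ≤ (A + 1) * n * Real.log n := by
    have := Nat.ceil_lt_add_one (a := A * n * Real.log n) (by positivity)
    nlinarith
  rcases le_or_gt D n with hDn | hDn
  · set T := ⌈C * (A + 1) * n * Real.log n ^ 2⌉₊ + ⌈C * n⌉₊ with hT
    have hT1 : (T : ℝ) ≤ D * n * Real.log n ^ 2 := by
      have h1 := Nat.ceil_lt_add_one (a := C * (A + 1) * n * Real.log n ^ 2) (by positivity)
      have h2 := Nat.ceil_lt_add_one (a := C * n) (by positivity)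
      have h3 : C * n ≤ 4 * C * (n * Real.log n ^ 2) := by
        have : 0 ≤ C * n := by positivity
        nlinarith
      have h4 : 2 ≤ 8 * (n * Real.log n ^ 2) := by nlinarith
      rw [hT]
      push_cast
      rw [hD]
      nlinarith
    have hT2 : T ≤ n ^ 4 := by
      have : (T : ℝ) ≤ (n : ℝ) ^ 4 := by
        calc (T : ℝ) ≤ _ := hT1
          _ ≤ n * n * n ^ 2 := by gcongr
          _ = _ := by ring
      exact_mod_cast this
    refine ⟨T, hT1.trans ?_, (h n hn τ q₀ hq).trans (measureReal_mono (fun ω hω i => ?_)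
      (measure_ne_top _ _))⟩
    · gcongr
      linarith [(by positivity : 0 < 2 * D * (A + 1))]
    · have hp := hω 0 T (by omega) (by
        rw [hT]
        push_cast
        have := Nat.le_ceil (C * n)
        linarith [(Nat.cast_nonneg _ : (0 : ℝ) ≤ (⌈C * (A + 1) * n * Real.log n ^ 2⌉₊ : ℝ))]) i
      have h1 : (A + 1) * n * Real.log n ≤ T / (C * Real.log n) := by
        rw [le_div_iff₀ (by positivity), hT]
        push_cast
        have h2 := Nat.le_ceil (C * (A + 1) * n * Real.log n ^ 2)
        have h3 : (0 : ℝ) ≤ (⌈C * n⌉₊ : ℝ) := Nat.cast_nonneg _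
        calc _ = C * (A + 1) * n * Real.log n ^ 2 := by ring
          _ ≤ _ := by linarith
      exact_mod_cast (hm.trans h1).trans hp
  · refine ⟨⌈A * n * Real.log n⌉₊ * n, ?_, ?_⟩
    · push_cast
      calc _ ≤ (A + 1) * n * Real.log n * n := by gcongr
        _ ≤ (A + 1) * n * Real.log n * D := by gcongr
        _ ≤ (A + 1) * n * Real.log n * D * (2 * Real.log n) :=
          le_mul_of_one_le_right (by positivity) (by linarith)
        _ = 2 * D * (A + 1) * n * Real.log n ^ 2 := by ring
        _ ≤ _ := by
          gcongr
          linarith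
    · refine one_sub_le_law (T := ∅) (fun ω _ i => ?_) (by
        rw [measureReal_empty]
        positivity)
      exact le_progress_mul τ hq ω i 0 _ n (by omega) fun r _ _ =>
        Finset.sup_le fun b _ => (isConfiguration_process τ hq ω r).length_le b

theorem exists_parallelCoverTime_le {n : ℕ} {τ : TieBreak n} {q₀ : Queues n} {ω : Choices n}
    {T : ℕ} (h : CoveredBy τ q₀ ω T) : ∃ T' : ℕ, parallelCoverTime τ q₀ ω = T' ∧ T' ≤ T := by
  have h1 : parallelCoverTime τ q₀ ω ≤ T := iInf₂_le T h
  obtain ⟨T', hT'⟩ := ENat.ne_top_iff_exists.1 (ne_top_of_le_ne_top (ENat.natCast_ne_top T) h1)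
  exact ⟨T', hT'.symm, by rw [← hT'] at h1; exact_mod_cast h1⟩

theorem exists_parallelCoverTime (γ : ℝ) (hγ : 0 < γ) :
    ∃ C : ℝ, 0 < C ∧ ∀ n : ℕ, 2 ≤ n → ∀ (τ : TieBreak n) (q₀ : Queues n),
      IsConfiguration q₀ → 1 - (n : ℝ) ^ (-γ) ≤ (law n).real
        {ω | ∃ T : ℕ, parallelCoverTime τ q₀ ω = T ∧ (T : ℝ) ≤ C * n * Real.log n ^ 2} := by
  -- With `(γ + 3) n log n` releases a given pair fails with probability at most `n ^ (-(γ + 3))`,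
  -- and the `n ^ 2` pairs together with `n ^ (-(γ + 1))`. The progress event fails with the same
  -- bound, and `n ≥ 2` absorbs the sum.
  obtain ⟨C, hC, h⟩ := exists_progress_ge (γ + 1) (γ + 3) (by linarith) (by linarith)
  refine ⟨C, hC, fun n hn τ q₀ hq => ?_⟩
  obtain ⟨T, hT, hp⟩ := h n hn τ q₀ hq
  have : NeZero n := ⟨by omega⟩
  have hn0 : (0 : ℝ) < n := by exact_mod_cast (by omega : 0 < n)
  set m := ⌈(γ + 3) * n * Real.log n⌉₊ with hm
  set P := {ω | ∀ i : Fin n, m ≤ progress τ q₀ ω i 0 T}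
  set U := ⋃ i ∈ (Finset.univ : Finset (Fin n)), ⋃ b ∈ (Finset.univ : Finset (Fin n)),
    {ω | Unvisited τ q₀ i b T ω ∧ m ≤ progress τ q₀ ω i 0 T}
  have hU : (law n).real U ≤ (n : ℝ) ^ (-(γ + 1)) := by
    have hib : ∀ i b : Fin n, (law n).real {ω | Unvisited τ q₀ i b T ω ∧
        m ≤ progress τ q₀ ω i 0 T} ≤ (n : ℝ) ^ (-(γ + 3)) := fun i b => by
      refine (law_unvisited_le τ q₀ hn i b T m).trans ?_
      calc (1 - 1 / n : ℝ) ^ m ≤ Real.exp (-(1 / n)) ^ m := by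
            gcongr
            · exact (one_sub_inv_pos hn).le
            · exact Real.one_sub_le_exp_neg _
        _ = Real.exp (-(m / n)) := by
            rw [← Real.exp_nat_mul]
            congr 1
            ring
        _ ≤ Real.exp (-((γ + 3) * Real.log n)) := by
            rw [Real.exp_le_exp, neg_le_neg_iff, le_div_iff₀ hn0]
            calc _ = (γ + 3) * n * Real.log n := by ring
              _ ≤ _ := Nat.le_ceil _
        _ = _ := by
            rw [Real.rpow_def_of_pos hn0]
            congr 1
            ring
    calc (law n).real U ≤ ∑ _i : Fin n, ∑ _b : Fin n, (n : ℝ) ^ (-(γ + 3)) :=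
          (measureReal_biUnion_finset_le _ _).trans (Finset.sum_le_sum fun i _ =>
            (measureReal_biUnion_finset_le _ _).trans (Finset.sum_le_sum fun b _ => hib i b))
      _ = (n : ℝ) ^ 2 * (n : ℝ) ^ (-(γ + 3)) := by
          simp
          ring
      _ = _ := by
          rw [← Real.rpow_natCast, ← Real.rpow_add hn0]
          congr 1
          push_cast
          ring
  have hsub : 1 - (n : ℝ) ^ (-(γ + 1)) - (law n).real U ≤ (law n).real (P \ U) := by
    have h1 : (law n).real P ≤ (law n).real (P \ U) + (law n).real U :=
      (measureReal_mono (fun ω hω => by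
        by_cases h : ω ∈ U
        · exact Or.inr h
        · exact Or.inl ⟨hω, h⟩) (measure_ne_top _ _)).trans (measureReal_union_le _ _)
    linarith
  have hhalf := rpow_neg_add_one_le_half hn γ
  refine le_trans (by linarith) (hsub.trans (measureReal_mono ?_ (measure_ne_top _ _)))
  rintro ω ⟨hP, hω⟩
  have hcov : CoveredBy τ q₀ ω T := fun i b => by
    by_contra! hu
    refine hω ?_
    simp only [U, Set.mem_iUnion]
    exact ⟨i, Finset.mem_univ i, b, Finset.mem_univ b, hu, hP i⟩
  obtain ⟨T', hT', hle⟩ := exists_parallelCoverTime_le hcov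
  exact ⟨T', hT', le_trans (by exact_mod_cast hle) hT⟩

end RepeatedBallsIntoBins

theorem mainTheorem2 (γ : ℝ) (hγ : 0 < γ) :
    -- progress of every ball, started from a legitimate configuration
    (∀ (c : ℕ) (K : ℝ), ∃ C : ℝ, 0 < C ∧ ∀ n : ℕ, 2 ≤ n →
      ∀ (τ : RepeatedBallsIntoBins.TieBreak n) (q₀ : RepeatedBallsIntoBins.Queues n),
        RepeatedBallsIntoBins.IsConfiguration q₀ → RepeatedBallsIntoBins.IsLegitimate K q₀ →
        1 - (n : ℝ) ^ (-γ) ≤ (RepeatedBallsIntoBins.law n).real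
          {ω | ∀ s t : ℕ, s + t ≤ n ^ c → C * Real.log n ≤ t → ∀ i : Fin n,
            (t : ℝ) / (C * Real.log n) ≤ RepeatedBallsIntoBins.progress τ q₀ ω i s t}) ∧
    -- progress of every ball, started from any configuration
    (∀ c : ℕ, ∃ C : ℝ, 0 < C ∧ ∀ n : ℕ, 2 ≤ n →
      ∀ (τ : RepeatedBallsIntoBins.TieBreak n) (q₀ : RepeatedBallsIntoBins.Queues n),
        RepeatedBallsIntoBins.IsConfiguration q₀ →
        1 - (n : ℝ) ^ (-γ) ≤ (RepeatedBallsIntoBins.law n).real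
          {ω | ∀ s t : ℕ, s + t ≤ n ^ c → C * n ≤ t → ∀ i : Fin n,
            (t : ℝ) / (C * Real.log n) ≤ RepeatedBallsIntoBins.progress τ q₀ ω i s t}) ∧
    -- parallel cover time, started from any configuration
    (∃ C : ℝ, 0 < C ∧ ∀ n : ℕ, 2 ≤ n →
      ∀ (τ : RepeatedBallsIntoBins.TieBreak n) (q₀ : RepeatedBallsIntoBins.Queues n),
        RepeatedBallsIntoBins.IsConfiguration q₀ →
        1 - (n : ℝ) ^ (-γ) ≤ (RepeatedBallsIntoBins.law n).real
          {ω | ∃ T : ℕ, RepeatedBallsIntoBins.parallelCoverTime τ q₀ ω = T ∧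
            (T : ℝ) ≤ C * n * Real.log n ^ 2}) := by
  exact ⟨RepeatedBallsIntoBins.exists_progress_of_isLegitimate γ hγ,
    RepeatedBallsIntoBins.exists_progress γ hγ,
    RepeatedBallsIntoBins.exists_parallelCoverTime γ hγ⟩
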